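/- For a topological space $X$, an open $\omega$-cover of $X$ is a family $\mathcal U$ of open subsets of $X$ such that every finite subset of $X$ is contained in some member of $\mathcal U$ but no member of $\mathcal U$ equals $X$; an open $\gamma$-cover of $X$ is an infinite family of open subsets of $X$ such that every point of $X$ belongs to all but finitely many of its members. A set $X\subseteq\mathbb R$ is a $\gamma$-set if, in the subspace topology, each open $\omega$-cover of $X$ contains an open $\gamma$-cover of $X$. A pseudo-intersection of a family $\mathcal F$ of infinite subsets of $\mathbb N$ is an infinite set $P\subseteq\mathbb N$ with $P\setminus B$ finite for all $B\in\mathcal F$; $\mathcal F$ is centered if each finite subfamily has a pseudo-intersection; and $\mathfrak p$ is the minimal cardinality of a centered family with no pseudo-intersection. Let $\mathfrak c=2^{\aleph_0}$, and let $\dim$ denote Hausdorff dimension. **Theorem.** Assume the Continuum Hypothesis, or just $\mathfrak p=\mathfrak c$. Then there exist a $\gamma$-set $X\subseteq\mathbb R$ and a set $Y\subseteq\mathbb R$ with $\dim(Y)=0$ such that the algebraic sum $X+Y=\{x+y : x\in X,\ y\in Y\}$, which is the image of $X\times Y\subseteq\mathbb R^2$ under the Lipschitz map $(x,y)\mapsto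 x+y$, has Hausdorff dimension $1$; in fact $X+Y=\mathbb R$. In particular, $\dim(X\times Y)\ge 1$. -/

import Mathlib

open scoped Pointwise Cardinal

/-! ### Gamma-sets -/

/-- `𝒰` is an open `ω`-cover of the space `X`: a family of open subsets of `X` such that every
finite subset of `X` is contained in some member of `𝒰`, while no member of `𝒰` is all of `X`. -/
def IsOpenOmegaCover {X : Type*} [TopologicalSpace X] (𝒰 : Set (Set X)) : Prop :=
  (∀ U ∈ 𝒰, IsOpen U) ∧
    (∀ F : Set X, F.Finite → ∃ U ∈ 𝒰, F ⊆ U) ∧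
    ∀ U ∈ 𝒰, U ≠ Set.univ

/-- `𝒱` is an open `γ`-cover of the space `X`: an infinite family of open subsets of `X` such that
every point of `X` belongs to all but finitely many members of `𝒱`. -/
def IsOpenGammaCover {X : Type*} [TopologicalSpace X] (𝒱 : Set (Set X)) : Prop :=
  (∀ V ∈ 𝒱, IsOpen V) ∧ 𝒱.Infinite ∧ ∀ x : X, {V ∈ 𝒱 | x ∉ V}.Finite

/-- A topological space is a `γ`-space if each of its open `ω`-covers contains an
open `γ`-cover. -/
def IsGammaSpace (X : Type*) [TopologicalSpace X] : Prop :=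
  ∀ 𝒰 : Set (Set X), IsOpenOmegaCover 𝒰 → ∃ 𝒱 ⊆ 𝒰, IsOpenGammaCover 𝒱

/-- A subset of a topological space is a `γ`-set if it is a `γ`-space in the subspace topology. -/
def IsGammaSet {Z : Type*} [TopologicalSpace Z] (X : Set Z) : Prop :=
  IsGammaSpace X

/-! ### The pseudo-intersection number and the Continuum Hypothesis -/

/-- `P` is a pseudo-intersection of the family `ℱ` of sets of natural numbers: `P` is infinite
and almost contained in every member of `ℱ`. -/
def IsPseudoIntersection (P : Set ℕ) (ℱ : Set (Set ℕ)) : Prop :=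
  P.Infinite ∧ ∀ B ∈ ℱ, (P \ B).Finite

/-- A family of infinite sets of natural numbers is centered if each of its finite subfamilies has
a pseudo-intersection. -/
def IsCentered (ℱ : Set (Set ℕ)) : Prop :=
  (∀ B ∈ ℱ, B.Infinite) ∧ ∀ 𝒢 ⊆ ℱ, 𝒢.Finite → ∃ P, IsPseudoIntersection P 𝒢

/-- The pseudo-intersection number `𝔭`: the minimal cardinality of a centered family which
has no pseudo-intersection. -/
noncomputable def pseudoIntersectionNumber : Cardinal.{0} :=
  sInf {κ | ∃ ℱ : Set (Set ℕ),
    IsCentered ℱ ∧ (¬ ∃ P, IsPseudoIntersection P ℱ) ∧ #ℱ = κ}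

/-- The Continuum Hypothesis. -/
def ContinuumHypothesis : Prop :=
  Cardinal.continuum.{0} = Cardinal.aleph 1

/-! ### Products of sets of reals -/

/-- The product `X × Y` of two sets of reals, as a subset of the Euclidean plane. -/
def planeProd (X Y : Set ℝ) : Set (EuclideanSpace ℝ (Fin 2)) :=
  {p | p 0 ∈ X ∧ p 1 ∈ Y}

/-! Expand reals in blocks of binary digits, the `n`-th block running from position `n!` to
`(n+1)!`. For an infinite set `a`, any real `r` splits as `x + y`, where `x` keeps the blocks in `a`
and `y` the others (`exists_isSupported_sub_mem_sparseReals`). Then `y` has infinitely many zero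
blocks, and such reals form a set `Y` of dimension zero, because each block is far longer than
everything before it.

To make the points `x` a γ-set, build by recursion of length `𝔠` an almost decreasing tower of
infinite sets `a i`, choosing `x i` supported in `a i` for the `i`-th real. Stage `i` also treats
the `i`-th sequence of basic open sets. If it catches all finite sets of earlier points, `𝔭 = 𝔠`
yields a sequence of its members eventually containing each earlier point; thinning `a i` makes a
subsequence eventually contain every real supported in `a i`
(`exists_infinite_subset_eventually_mem`), hence `x i` and all later points. Under CH the needed
pseudo-intersections come from diagonalization. Addition is Lipschitz, so it cannot raise dimension.
-/

section

open Set Filter Topology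
open scoped ENNReal MeasureTheory

/-! ### Pseudo-intersections of small families -/

/-- Every centered family of fewer than `𝔠` sets has a pseudo-intersection. -/
def SmallCenteredHavePseudoIntersection : Prop :=
  ∀ ℱ : Set (Set ℕ), IsCentered ℱ → #ℱ < Cardinal.continuum → ∃ P, IsPseudoIntersection P ℱ

theorem IsPseudoIntersection.infinite_sInter {P : Set ℕ} {ℱ : Set (Set ℕ)}
    (h : IsPseudoIntersection P ℱ) (hℱ : ℱ.Finite) : (⋂₀ ℱ).Infinite := by
  intro hfin
  refine h.1 ((hfin.union (hℱ.biUnion fun B hB => h.2 B hB)).subset fun k hk => ?_)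
  by_cases hk' : k ∈ ⋂₀ ℱ
  · exact Or.inl hk'
  · rw [mem_sInter] at hk'
    push Not at hk'
    obtain ⟨B, hB, hkB⟩ := hk'
    exact Or.inr (mem_biUnion hB ⟨hk, hkB⟩)

theorem IsCentered.exists_isPseudoIntersection_of_countable {ℱ : Set (Set ℕ)}
    (h : IsCentered ℱ) (hc : ℱ.Countable) : ∃ P, IsPseudoIntersection P ℱ := by
  rcases ℱ.eq_empty_or_nonempty with rfl | hne
  · exact h.2 ∅ Subset.rfl finite_empty
  obtain ⟨B, rfl⟩ := hc.exists_eq_range hne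
  -- Diagonalization: the `n`-th point lies in the first `n + 1` sets, so `B i` can miss only the
  -- points with index below `i`.
  have hex : ∀ n : ℕ, ∃ k, n < k ∧ ∀ i ≤ n, k ∈ B i := by
    intro n
    have hfin : (B '' Iic n).Finite := (finite_Iic n).image B
    obtain ⟨P, hP⟩ := h.2 (B '' Iic n) (image_subset_range _ _) hfin
    obtain ⟨k, hk, hnk⟩ := (hP.infinite_sInter hfin).exists_gt n
    exact ⟨k, hnk, fun i hi => hk _ (mem_image_of_mem B hi)⟩
  choose p hp hpB using hex
  refine ⟨range p, infinite_of_forall_exists_gt fun n => ⟨p n, mem_range_self n, hp n⟩, ?_⟩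
  rintro _ ⟨i, rfl⟩
  refine ((finite_Iio i).image p).subset ?_
  rintro _ ⟨⟨n, rfl⟩, hn⟩
  refine mem_image_of_mem p ?_
  by_contra hni
  exact hn (hpB n i (not_lt.1 hni))

theorem smallCenteredHavePseudoIntersection
    (h : ContinuumHypothesis ∨ pseudoIntersectionNumber = Cardinal.continuum) :
    SmallCenteredHavePseudoIntersection := by
  intro ℱ hℱ hcard
  rcases h with h | h
  · refine hℱ.exists_isPseudoIntersection_of_countable ?_
    rw [ContinuumHypothesis] at h
    rw [h, ← Cardinal.succ_aleph0, Order.lt_succ_iff] at hcard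
    exact Cardinal.le_aleph0_iff_set_countable.1 hcard
  · by_contra hP
    rw [← h] at hcard
    exact hcard.not_ge (csInf_le' ⟨ℱ, hℱ, hP, rfl⟩)

/-- If `X` has fewer than `𝔠` points, then every sequence of sets which catches all finite subsets
of `X` has a rearranged subsequence which eventually contains each point of `X`. -/
theorem SmallCenteredHavePseudoIntersection.exists_eventually_mem {α : Type}
    (h : SmallCenteredHavePseudoIntersection) {X : Set α} (hX : #X < Cardinal.continuum)
    (U : ℕ → Set α) (hU : ∀ F ⊆ X, F.Finite → ∃ k, F ⊆ U k) :
    ∃ g : ℕ → ℕ, ∀ x ∈ X, ∀ᶠ i in atTop, x ∈ U (g i) := by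
  -- Unpairing repeats every index infinitely often, so a single `U k` catching `F` already makes
  -- the intersection infinite.
  set B : X → Set ℕ := fun x => {k | (x : α) ∈ U k.unpair.1} with hB
  have hinf : ∀ F : Set X, F.Finite → (⋂ x ∈ F, B x).Infinite := by
    intro F hF
    obtain ⟨k, hk⟩ := hU ((↑) '' F) (by rintro _ ⟨x, -, rfl⟩; exact x.2) (hF.image _)
    refine infinite_of_forall_exists_gt fun n => ⟨Nat.pair k (n + 1), ?_, ?_⟩
    · simp only [hB, mem_iInter, mem_ofPred_eq, Nat.unpair_pair]
      exact fun x hx => hk (mem_image_of_mem _ hx)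
    · exact (Nat.lt_succ_self n).trans_le (Nat.right_le_pair _ _)
  have hcent : IsCentered (range B) := by
    constructor
    · rintro _ ⟨x, rfl⟩
      simpa using hinf {x} (finite_singleton x)
    · intro 𝒢 h𝒢 hfin
      obtain ⟨F, hF, hFfin, rfl⟩ := (exists_subset_image_finite_and (p := fun G => 𝒢 = G)
        (f := B) (s := univ)).1 ⟨𝒢, by simpa using h𝒢, hfin, rfl⟩
      refine ⟨_, hinf F hFfin, ?_⟩
      rintro _ ⟨x, hx, rfl⟩
      convert finite_empty
      exact sdiff_eq_empty.2 (biInter_subset_of_mem hx)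
  obtain ⟨P, hP, hPB⟩ := h _ hcent (Cardinal.mk_range_le.trans_lt hX)
  refine ⟨fun i => (Nat.nth (· ∈ P) i).unpair.1, fun x hx => ?_⟩
  have hev : ∀ᶠ k in atTop, k ∉ P \ B ⟨x, hx⟩ := by
    rw [← Nat.cofinite_eq_atTop]
    exact (hPB _ (mem_range_self _)).compl_mem_cofinite
  filter_upwards [(Nat.nth_strictMono hP).tendsto_atTop.eventually hev] with i hi
  by_contra hxi
  exact hi ⟨Nat.nth_mem_of_infinite hP i, hxi⟩

/-- A family of infinite sets indexed by a linear order which is decreasing modulo finite sets has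
a pseudo-intersection if it is small. -/
theorem SmallCenteredHavePseudoIntersection.exists_pseudoIntersection_of_tower {ι : Type}
    [LinearOrder ι] (h : SmallCenteredHavePseudoIntersection) (hι : #ι < Cardinal.continuum)
    (a : ι → Set ℕ) (ha : ∀ i, (a i).Infinite) (hdec : ∀ i j, i < j → (a j \ a i).Finite) :
    ∃ b : Set ℕ, b.Infinite ∧ ∀ i, (b \ a i).Finite := by
  have hcent : IsCentered (range a) := by
    refine ⟨by rintro _ ⟨i, rfl⟩; exact ha i, fun 𝒢 h𝒢 hfin => ?_⟩
    obtain ⟨F, hF, hFfin, rfl⟩ := (exists_subset_image_finite_and (p := fun G => 𝒢 = G)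
        (f := a) (s := univ)).1 ⟨𝒢, by simpa using h𝒢, hfin, rfl⟩
    rcases F.eq_empty_or_nonempty with rfl | hne
    · exact ⟨univ, infinite_univ, by simp⟩
    obtain ⟨j, hj, hmax⟩ := exists_max_image F id hFfin hne
    refine ⟨a j, ha j, ?_⟩
    rintro _ ⟨i, hi, rfl⟩
    rcases (hmax i hi).lt_or_eq with hlt | heq
    · exact hdec i j hlt
    · simp only [id] at heq
      simp [heq]
  obtain ⟨b, hb, hba⟩ := h _ hcent (Cardinal.mk_range_le.trans_lt hι)
  exact ⟨b, hb, fun i => hba _ (mem_range_self i)⟩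

/-! ### Reduction of the γ-property to sequences -/

/-- A second countable space has a countable family of open sets that interpolates between finite
sets and their open neighbourhoods. -/
theorem exists_seq_isOpen_interpolating (Z : Type*) [TopologicalSpace Z]
    [SecondCountableTopology Z] :
    ∃ e : ℕ → Set Z, (∀ k, IsOpen (e k)) ∧
      ∀ F U : Set Z, F.Finite → IsOpen U → F ⊆ U → ∃ k, F ⊆ e k ∧ e k ⊆ U := by
  have hbasis := TopologicalSpace.isBasis_countableBasis Z
  have hcount : (sUnion '' {s : Set (Set Z) | s.Finite ∧
      s ⊆ TopologicalSpace.countableBasis Z}).Countable :=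
    (countable_ofPred_finite_subset (TopologicalSpace.countable_countableBasis Z)).image _
  obtain ⟨e, he⟩ := hcount.exists_eq_range ⟨_, ∅, ⟨finite_empty, empty_subset _⟩, rfl⟩
  refine ⟨e, fun k => ?_, fun F U hF hU hFU => ?_⟩
  · obtain ⟨s, ⟨-, hs⟩, hsk⟩ : e k ∈ sUnion '' _ := he ▸ mem_range_self k
    rw [← hsk]
    exact isOpen_sUnion fun t ht => TopologicalSpace.isOpen_of_mem_countableBasis (hs ht)
  · have hex : ∀ x ∈ F, ∃ t ∈ TopologicalSpace.countableBasis Z, x ∈ t ∧ t ⊆ U :=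
      fun x hx => hbasis.exists_subset_of_mem_open (hFU hx) hU
    choose! t ht hxt htU using hex
    have hmem : ⋃₀ (t '' F) ∈ range e := by
      rw [← he]
      exact ⟨t '' F, ⟨hF.image t, by rintro _ ⟨x, hx, rfl⟩; exact ht x hx⟩, rfl⟩
    obtain ⟨k, hk⟩ := hmem
    refine ⟨k, ?_, ?_⟩
    · rw [hk]
      exact fun x hx => ⟨t x, mem_image_of_mem t hx, hxt x hx⟩
    · rw [hk]
      rintro z ⟨_, ⟨x, hx, rfl⟩, hz⟩
      exact htU x hx hz

/-- A sufficient condition for a subset of a space to be a `γ`-set, in terms of sequences drawn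
from an interpolating sequence `e` of open sets. -/
theorem isGammaSet_of_forall_seq {Z : Type*} [TopologicalSpace Z] {X : Set Z} {e : ℕ → Set Z}
    (hint : ∀ F U : Set Z, F.Finite → IsOpen U → F ⊆ U → ∃ k, F ⊆ e k ∧ e k ⊆ U)
    (hX : ∀ s : ℕ → ℕ, (∀ F ⊆ X, F.Finite → ∃ k, F ⊆ e (s k)) →
      ∃ g : ℕ → ℕ, ∀ x ∈ X, ∀ᶠ i in atTop, x ∈ e (s (g i))) :
    IsGammaSet X := by
  rintro 𝒰 ⟨hopen, hcov, hne⟩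
  -- Replacing cover members by smaller sets `e k` leaves only sequences of naturals to treat, of
  -- which there are just `𝔠`.
  have hcatch : ∀ F ⊆ X, F.Finite → ∃ k, (∃ U ∈ 𝒰, ((↑) : X → Z) ⁻¹' e k ⊆ U) ∧ F ⊆ e k := by
    intro F hFX hF
    obtain ⟨U, hU, hFU⟩ := hcov ((↑) ⁻¹' F) (hF.preimage Subtype.val_injective.injOn)
    obtain ⟨V, hV, rfl⟩ := isOpen_induced_iff.1 (hopen U hU)
    obtain ⟨k, hFk, hkV⟩ := hint F V hF hV fun x hx => hFU (a := ⟨x, hFX hx⟩) hx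
    exact ⟨k, ⟨_, hU, preimage_mono hkV⟩, hFk⟩
  have hK : {k | ∃ U ∈ 𝒰, ((↑) : X → Z) ⁻¹' e k ⊆ U}.Nonempty := by
    obtain ⟨k, hk, -⟩ := hcatch ∅ (empty_subset _) finite_empty
    exact ⟨k, hk⟩
  obtain ⟨s, hs⟩ := (to_countable {k | ∃ U ∈ 𝒰, ((↑) : X → Z) ⁻¹' e k ⊆ U}).exists_eq_range hK
  have hsU : ∀ i, ∃ U ∈ 𝒰, ((↑) : X → Z) ⁻¹' e (s i) ⊆ U := fun i => by
    have : s i ∈ {k | ∃ U ∈ 𝒰, ((↑) : X → Z) ⁻¹' e k ⊆ U} := hs ▸ mem_range_self i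
    exact this
  choose V hV hsV using hsU
  obtain ⟨g, hg⟩ := hX s fun F hFX hF => by
    obtain ⟨k, hk, hFk⟩ := hcatch F hFX hF
    obtain ⟨i, rfl⟩ : k ∈ range s := hs ▸ hk
    exact ⟨i, hFk⟩
  have hgV : ∀ x : X, ∀ᶠ i in atTop, x ∈ V (g i) := fun x =>
    (hg x x.2).mono fun i hi => hsV _ hi
  refine ⟨range fun i => V (g i), ?_, ?_, ?_, fun x => ?_⟩
  · rintro _ ⟨i, rfl⟩
    exact hV _
  · rintro _ ⟨i, rfl⟩
    exact hopen _ (hV _)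
  -- If the range were finite, one member would recur infinitely often and so contain every point,
  -- which an ω-cover forbids.
  · intro hfin
    have := hfin.to_subtype
    obtain ⟨⟨W, i₀, rfl⟩, hW⟩ :=
      Finite.exists_infinite_fiber (fun i => (⟨V (g i), mem_range_self i⟩ : range fun i => V (g i)))
    refine hne _ (hV (g i₀)) (eq_univ_of_forall fun x => ?_)
    obtain ⟨N, hN⟩ := eventually_atTop.1 (hgV x)
    obtain ⟨i, hi, hNi⟩ := (infinite_coe_iff.1 hW).exists_gt N
    have hi' : V (g i) = V (g i₀) := congrArg Subtype.val hi
    exact hi' ▸ hN i hNi.le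
  · have hfin : {i | x ∉ V (g i)}.Finite := by
      have := hgV x
      rw [← Nat.cofinite_eq_atTop] at this
      exact this
    refine (hfin.image fun i => V (g i)).subset ?_
    rintro _ ⟨⟨i, rfl⟩, hi⟩
    exact mem_image_of_mem _ hi

/-! ### Blocks of digits -/

/-- The denominators of the digit expansion used to build sets of dimension zero. -/
def denom (n : ℕ) : ℕ := 2 ^ n.factorial

theorem denom_pos (n : ℕ) : 0 < denom n := by unfold denom; positivity

/-- The unbounded exponent `n + 1` is what forces dimension zero. -/
theorem denom_succ (n : ℕ) : denom (n + 1) = denom n ^ (n + 1) := by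
  rw [denom, denom, ← pow_mul, Nat.factorial_succ, mul_comm]

theorem two_pow_le_denom (n : ℕ) : 2 ^ n ≤ denom n :=
  Nat.pow_le_pow_right two_pos n.self_le_factorial

theorem denom_dvd_succ (n : ℕ) : denom n ∣ denom (n + 1) := by
  rw [denom_succ]; exact dvd_pow_self _ n.succ_ne_zero

theorem denom_dvd {m n : ℕ} (h : m ≤ n) : denom m ∣ denom n :=
  Nat.le_induction dvd_rfl (fun k _ ih => ih.trans (denom_dvd_succ k)) n h

theorem tendsto_inv_denom : Tendsto (fun n => (denom n : ℝ)⁻¹) atTop (𝓝 0) := by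
  refine tendsto_inv_atTop_zero.comp (tendsto_natCast_atTop_atTop.comp ?_)
  exact tendsto_atTop_mono (fun n => (Nat.lt_two_pow_self (n := n)).le.trans (two_pow_le_denom n))
    tendsto_id

/-- Some `p / denom m` is within distance `1 / denom n` of `x`. -/
def IsApprox (x : ℝ) (m n : ℕ) : Prop :=
  ∃ p : ℤ, |x - p / denom m| ≤ (denom n : ℝ)⁻¹

/-- The nonzero blocks of digits of `x` are almost all indexed by elements of `a`. -/
def IsSupported (x : ℝ) (a : Set ℕ) : Prop :=
  ∀ᶠ m in atTop, ∀ n ≥ m, Disjoint a (Ico m n) → IsApprox x m n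

/-- Intervals starting beyond the last element of `a \ b` cannot distinguish the two sets. -/
theorem IsSupported.mono {x : ℝ} {a b : Set ℕ} (h : IsSupported x a) (hab : (a \ b).Finite) :
    IsSupported x b := by
  obtain ⟨N, hN⟩ := hab.bddAbove
  filter_upwards [h, eventually_gt_atTop N] with m hm hNm n hmn hdisj
  refine hm n hmn (disjoint_left.2 fun k hka hk => ?_)
  by_cases hkb : k ∈ b
  · exact disjoint_left.1 hdisj hkb hk
  · exact absurd (hN ⟨hka, hkb⟩) (not_le.2 (hNm.trans_le hk.1))

/-- The truncation of `r` to a multiple of `1 / denom n`. -/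
noncomputable def trunc (r : ℝ) (n : ℕ) : ℝ := ⌊r * denom n⌋ / denom n

theorem trunc_le (r : ℝ) (n : ℕ) : trunc r n ≤ r := by
  have : (0 : ℝ) < denom n := by exact_mod_cast denom_pos n
  rw [trunc, div_le_iff₀ this]
  exact Int.floor_le _

theorem sub_trunc_le (r : ℝ) (n : ℕ) : r - trunc r n ≤ (denom n : ℝ)⁻¹ := by
  have h : (0 : ℝ) < denom n := by exact_mod_cast denom_pos n
  rw [trunc, sub_le_iff_le_add, ← one_div, ← add_div, le_div_iff₀ h, add_comm]
  exact (Int.lt_floor_add_one _).le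

theorem trunc_mono (r : ℝ) : Monotone (trunc r) := by
  refine monotone_nat_of_le_succ fun n => ?_
  obtain ⟨k, hk⟩ := denom_dvd_succ n
  have h : (0 : ℝ) < denom n := by exact_mod_cast denom_pos n
  have h' : (0 : ℝ) < denom (n + 1) := by exact_mod_cast denom_pos (n + 1)
  have hle : ⌊r * denom n⌋ * (k : ℤ) ≤ ⌊r * denom (n + 1)⌋ := by
    rw [Int.le_floor, hk]
    push_cast
    rw [← mul_assoc]
    exact mul_le_mul_of_nonneg_right (Int.floor_le _) (Nat.cast_nonneg k)
  rw [trunc, trunc, div_le_div_iff₀ h h']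
  calc (⌊r * denom n⌋ : ℝ) * denom (n + 1) = ((⌊r * denom n⌋ * (k : ℤ) : ℤ) : ℝ) * denom n := by
        rw [hk]; push_cast; ring
    _ ≤ _ := mul_le_mul_of_nonneg_right (by exact_mod_cast hle) h.le

theorem tendsto_trunc (r : ℝ) : Tendsto (trunc r) atTop (𝓝 r) := by
  have h := (tendsto_const_nhds (x := r)).sub tendsto_inv_denom
  rw [sub_zero] at h
  exact tendsto_of_tendsto_of_tendsto_of_le_of_le h tendsto_const_nhds
    (fun n => by simpa using sub_le_comm.1 (sub_trunc_le r n)) (trunc_le r)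

/-- The `n`-th block of digits of `r`. -/
noncomputable def block (r : ℝ) (n : ℕ) : ℝ := trunc r (n + 1) - trunc r n

theorem block_nonneg (r : ℝ) (n : ℕ) : 0 ≤ block r n := sub_nonneg.2 (trunc_mono r n.le_succ)

theorem hasSum_block (r : ℝ) (n : ℕ) :
    HasSum (fun j => block r (j + n)) (r - trunc r n) := by
  rw [hasSum_iff_tendsto_nat_of_nonneg fun j => block_nonneg r _]
  have h : ∀ k, ∑ j ∈ Finset.range k, block r (j + n) = trunc r (k + n) - trunc r n := by
    intro k
    have := Finset.sum_range_sub (fun j => trunc r (j + n)) k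
    simpa [block, add_right_comm] using this
  simp only [h]
  exact (((tendsto_add_atTop_iff_nat n).2 (tendsto_trunc r)).sub_const _)

theorem exists_int_div_of_dvd (x : ℝ) {m n : ℕ} (h : m ≤ n) (hx : ∃ p : ℤ, x = p / denom m) :
    ∃ p : ℤ, x = p / denom n := by
  obtain ⟨p, rfl⟩ := hx
  obtain ⟨k, hk⟩ := denom_dvd h
  have hm : (denom m : ℝ) ≠ 0 := by exact_mod_cast (denom_pos m).ne'
  have hn : (denom n : ℝ) ≠ 0 := by exact_mod_cast (denom_pos n).ne'
  refine ⟨p * k, ?_⟩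
  rw [div_eq_div_iff hm hn, hk]
  push_cast
  ring

theorem exists_int_div_sum_block (r : ℝ) (a : Set ℕ) (m : ℕ) :
    ∃ p : ℤ, ∑ j ∈ Finset.range m, a.indicator (block r) j = p / denom m := by
  induction m with
  | zero => exact ⟨0, by simp⟩
  | succ m ih =>
    obtain ⟨p, hp⟩ := exists_int_div_of_dvd _ m.le_succ ih
    obtain ⟨q, hq⟩ := exists_int_div_of_dvd (trunc r m) m.le_succ ⟨_, rfl⟩
    rw [Finset.sum_range_succ, hp]
    by_cases hm : m ∈ a
    · refine ⟨p + (⌊r * denom (m + 1)⌋ - q), ?_⟩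
      rw [indicator_of_mem hm, block, hq, trunc]
      push_cast
      ring
    · exact ⟨p, by rw [indicator_of_notMem hm, add_zero]⟩

/-- Blocks below `m` sum to a multiple of `1 / denom m`, those in `[m, n)` vanish, and the tail is
at most `r - trunc r n`. -/
theorem isApprox_of_disjoint (r : ℝ) (a : Set ℕ) {m n : ℕ} (hmn : m ≤ n)
    (h : Disjoint a (Ico m n)) {q : ℝ} (hq : ∃ p : ℤ, q = p / denom m) :
    IsApprox (q + ∑' j, a.indicator (block r) j) m n := by
  obtain ⟨p, hp⟩ := exists_int_div_sum_block r a m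
  obtain ⟨p', rfl⟩ := hq
  have hsum : Summable (a.indicator (block r)) := by
    have := (hasSum_block r 0).summable
    simp only [add_zero] at this
    exact this.indicator a
  have hle : ∀ j, a.indicator (block r) (j + n) ≤ block r (j + n) := fun j =>
    indicator_le_self' (fun _ _ => block_nonneg r _) _
  have hnn : ∀ j, 0 ≤ a.indicator (block r) j := fun j =>
    indicator_nonneg (fun _ _ => block_nonneg r _) _
  have hmn' : ∑ j ∈ Finset.range n, a.indicator (block r) j =
      ∑ j ∈ Finset.range m, a.indicator (block r) j := by
    refine (Finset.sum_subset (Finset.range_mono hmn) fun j hjn hjm => ?_).symm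
    refine indicator_of_notMem (fun hja => disjoint_left.1 h hja ?_) _
    exact ⟨not_lt.1 fun hj => hjm (Finset.mem_range.2 hj), Finset.mem_range.1 hjn⟩
  refine ⟨p' + p, ?_⟩
  have hrest : (p' : ℝ) / denom m + ∑' j, a.indicator (block r) j -
      ((p' + p : ℤ) : ℝ) / denom m = ∑' j, a.indicator (block r) (j + n) := by
    rw [← hsum.sum_add_tsum_nat_add n, hmn', hp]
    push_cast
    ring
  rw [hrest, abs_of_nonneg (tsum_nonneg fun j => hnn _)]
  calc ∑' j, a.indicator (block r) (j + n) ≤ ∑' j, block r (j + n) :=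
        ((summable_nat_add_iff n).2 hsum).tsum_le_tsum hle (hasSum_block r n).summable
    _ = r - trunc r n := (hasSum_block r n).tsum_eq
    _ ≤ _ := sub_trunc_le r n

/-- The reals with infinitely many zero blocks of digits. -/
def SparseReals : Set ℝ := {y | ∃ᶠ n in atTop, IsApprox y n (n + 1)}

theorem exists_isSupported_sub_mem_sparseReals (r : ℝ) {a : Set ℕ} (ha : a.Infinite) :
    ∃ x, IsSupported x a ∧ r - x ∈ SparseReals := by
  have hs : HasSum (block r) (r - trunc r 0) := by simpa using hasSum_block r 0
  have hsplit : r - ∑' j, a.indicator (block r) j =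
      trunc r 0 + ∑' j, aᶜ.indicator (block r) j := by
    have h := (hs.summable.indicator a).tsum_add (hs.summable.indicator aᶜ)
    have h' : ∀ j, a.indicator (block r) j + aᶜ.indicator (block r) j = block r j := fun j =>
      congrFun (indicator_self_add_compl a (block r)) j
    simp only [h', hs.tsum_eq] at h
    linarith
  refine ⟨∑' j, a.indicator (block r) j, .of_forall fun m n hmn hd => ?_, ?_⟩
  · simpa using isApprox_of_disjoint r a hmn hd (q := 0) ⟨0, by simp⟩
  · rw [hsplit]
    refine (Nat.frequently_atTop_iff_infinite.2 ha).mono fun n hn => ?_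
    refine isApprox_of_disjoint r _ n.le_succ ?_ (exists_int_div_of_dvd _ n.zero_le ⟨_, rfl⟩)
    refine disjoint_left.2 fun j hj hjn => hj ?_
    rwa [show j = n from le_antisymm (Nat.lt_succ_iff.1 hjn.2) hjn.1]

/-! ### Thinning the support -/

/-- An open neighbourhood of a finite set of rationals contains all sufficiently good
approximations of its points. -/
theorem eventually_forall_mem_of_abs_sub_le {W : Set ℝ} (hW : IsOpen W) (m : ℕ) (S : Finset ℤ)
    (hS : ∀ p ∈ S, (p : ℝ) / denom m ∈ W) :
    ∀ᶠ n in atTop, ∀ p ∈ S, ∀ y : ℝ, |y - p / denom m| ≤ (denom n : ℝ)⁻¹ → y ∈ W := by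
  rw [Filter.eventually_all_finset]
  intro p hp
  obtain ⟨δ, hδ, hball⟩ := Metric.isOpen_iff.1 hW _ (hS p hp)
  filter_upwards [tendsto_inv_denom.eventually_lt_const hδ] with n hn y hy
  exact hball (by rw [Metric.mem_ball, Real.dist_eq]; exact hy.trans_lt hn)

/-- A sequence of open sets which eventually contains each rational eventually contains, along a
subsequence, each real supported in a suitable infinite subset of a given infinite set. -/
theorem exists_infinite_subset_eventually_mem {W : ℕ → Set ℝ} (hW : ∀ i, IsOpen (W i))
    (hq : ∀ q : ℚ, ∀ᶠ i in atTop, (q : ℝ) ∈ W i) {b : Set ℕ} (hb : b.Infinite) :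
    ∃ a ⊆ b, a.Infinite ∧ ∃ φ : ℕ → ℕ, StrictMono φ ∧
      ∀ y, IsSupported y a → ∀ᶠ i in atTop, y ∈ W (φ i) := by
  -- A state is the last element `n` put in `a` and the last index used. Block `n` may be nonzero,
  -- hence the denominator at `n + 1`; `n` also bounds the rationals considered, so that they are
  -- finitely many.
  have hstep : ∀ s : ℕ × ℕ, ∃ t : ℕ × ℕ, s.1 < t.1 ∧ t.1 ∈ b ∧ s.2 < t.2 ∧
      ∀ p ∈ Finset.Icc (-(s.1 * denom (s.1 + 1) : ℤ)) (s.1 * denom (s.1 + 1)),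
        ∀ y : ℝ, |y - p / denom (s.1 + 1)| ≤ (denom t.1 : ℝ)⁻¹ → y ∈ W t.2 := by
    rintro ⟨n, k⟩
    set S := Finset.Icc (-(n * denom (n + 1) : ℤ)) (n * denom (n + 1))
    have hev : ∀ᶠ i in atTop, ∀ p ∈ S, (p : ℝ) / denom (n + 1) ∈ W i := by
      rw [Filter.eventually_all_finset]
      exact fun p _ => by simpa using hq (p / denom (n + 1))
    obtain ⟨k', hk', hkk'⟩ := (hev.and (eventually_gt_atTop k)).exists
    obtain ⟨n', hn'b, hn', hnn'⟩ := ((Nat.frequently_atTop_iff_infinite.2 hb).and_eventually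
      ((eventually_forall_mem_of_abs_sub_le (hW k') (n + 1) S hk').and
        (eventually_gt_atTop n))).exists
    exact ⟨(n', k'), hnn', hn'b, hkk', hn'⟩
  choose T hT1 hTb hT2 hTW using hstep
  obtain ⟨n₀, hn₀⟩ := hb.nonempty
  set s : ℕ → ℕ × ℕ := fun i => T^[i] (n₀, 0)
  have hs : ∀ i, s (i + 1) = T (s i) := fun i => Function.iterate_succ_apply' T i _
  have hmono : StrictMono fun i => (s i).1 := strictMono_nat_of_lt_succ fun i => by
    simpa only [hs] using hT1 (s i)
  refine ⟨range fun i => (s i).1, ?_, infinite_range_of_injective hmono.injective,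
    fun i => (s (i + 1)).2, strictMono_nat_of_lt_succ fun i => ?_, fun y hy => ?_⟩
  · rintro _ ⟨_ | i, rfl⟩
    · exact hn₀
    · simp only [hs]
      exact hTb _
  · simpa only [hs (i + 1)] using hT2 (s (i + 1))
  -- The extra `1` absorbs the approximation error.
  · obtain ⟨L, hL⟩ := exists_nat_ge (|y| + 1)
    have htend := hmono.tendsto_atTop
    filter_upwards [htend.eventually ((tendsto_add_atTop_nat 1).eventually hy),
      htend.eventually_ge_atTop L] with i hi hLi
    have hlt : (s i).1 < (s (i + 1)).1 := hmono i.lt_succ_self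
    obtain ⟨p, hp⟩ := hi (s (i + 1)).1 hlt (by
      rw [disjoint_left]
      rintro _ ⟨j, rfl⟩ ⟨hj1, hj2⟩
      have h1 := hmono.lt_iff_lt.1 (Nat.lt_of_succ_le hj1)
      have h2 := hmono.lt_iff_lt.1 hj2
      omega)
    rw [hs] at hp ⊢
    refine hTW (s i) p ?_ y hp
    set n := (s i).1
    have hD : (0 : ℝ) < denom (n + 1) := by exact_mod_cast denom_pos _
    have hle1 : (denom (T (s i)).1 : ℝ)⁻¹ ≤ 1 :=
      inv_le_one_of_one_le₀ (by exact_mod_cast denom_pos _)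
    have hpn : |(p : ℝ) / denom (n + 1)| ≤ n := by
      have h1 := abs_sub_abs_le_abs_sub ((p : ℝ) / denom (n + 1)) y
      rw [abs_sub_comm] at h1
      have h2 : (L : ℝ) ≤ n := by exact_mod_cast hLi
      linarith
    rw [abs_div, abs_of_pos hD, div_le_iff₀ hD] at hpn
    rw [Finset.mem_Icc, ← abs_le]
    exact_mod_cast hpn

/-! ### Hausdorff dimension of the sparse reals -/

theorem card_mul_rpow_le (L : ℕ) {d : ℝ} {n : ℕ} (hn : 2 ≤ (n + 1) * d) :
    (2 * ((L + 1) * denom n) + 1) * (2 * (denom (n + 1) : ℝ)⁻¹) ^ d ≤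
      (2 * L + 3) * 2 ^ d * (2⁻¹) ^ n := by
  have hM : (2 : ℝ) ^ n ≤ denom n := by exact_mod_cast two_pow_le_denom n
  have hM1 : (1 : ℝ) ≤ denom n := by exact_mod_cast denom_pos n
  set M : ℝ := (denom n : ℝ)
  have hM0 : 0 < M := by linarith
  -- Exponent `2` suffices: one factor `M⁻¹` cancels the number of intervals, the other gives
  -- geometric decay.
  have hpow : (2 * (denom (n + 1) : ℝ)⁻¹) ^ d ≤ 2 ^ d * (M ^ 2)⁻¹ := by
    rw [Real.mul_rpow two_pos.le (by positivity)]
    refine mul_le_mul_of_nonneg_left ?_ (by positivity)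
    rw [denom_succ, Nat.cast_pow, Real.inv_rpow (by positivity), ← Real.rpow_natCast,
      ← Real.rpow_natCast, ← Real.rpow_mul hM0.le]
    refine inv_anti₀ (by positivity) (Real.rpow_le_rpow_of_exponent_le hM1 ?_)
    exact_mod_cast hn
  calc (2 * ((L + 1) * M) + 1) * (2 * (denom (n + 1) : ℝ)⁻¹) ^ d
      ≤ ((2 * L + 3) * M) * (2 ^ d * (M ^ 2)⁻¹) :=
        mul_le_mul (by nlinarith) hpow (by positivity) (by positivity)
    _ = (2 * L + 3) * 2 ^ d * M⁻¹ := by field_simp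
    _ ≤ _ := by
        refine mul_le_mul_of_nonneg_left ?_ (by positivity)
        rw [inv_pow]
        exact inv_anti₀ (by positivity) hM

theorem hausdorffMeasure_sparseReals_inter (L : ℕ) {d : ℝ} (hd : 0 < d) :
    μH[d] (SparseReals ∩ {y | |y| ≤ L}) = 0 := by
  set K : ℕ → ℤ := fun n => (L + 1) * denom n
  -- For each `N`, the intervals of all levels `N + j` together cover, since a sparse real is well
  -- approximated at some level beyond `N`.
  set t : (N : ℕ) → (Σ j : ℕ, Finset.Icc (-K (N + j)) (K (N + j))) → Set ℝ := fun N i =>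
    Icc ((i.2 : ℤ) / denom (N + i.1) - (denom (N + i.1 + 1) : ℝ)⁻¹)
      ((i.2 : ℤ) / denom (N + i.1) + (denom (N + i.1 + 1) : ℝ)⁻¹) with ht
  have hdiam : ∀ N i, Metric.ediam (t N i) =
      ENNReal.ofReal (2 * (denom (N + i.1 + 1) : ℝ)⁻¹) := fun N i => by
    rw [ht, Real.ediam_Icc]
    congr 1
    ring
  have hanti : Antitone fun n => (denom n : ℝ)⁻¹ := fun m n hmn =>
    inv_anti₀ (by exact_mod_cast denom_pos m)
      (by exact_mod_cast Nat.le_of_dvd (denom_pos n) (denom_dvd hmn))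
  have hr : Tendsto (fun N => ENNReal.ofReal (2 * (denom N : ℝ)⁻¹)) atTop (𝓝 0) := by
    simpa using ENNReal.tendsto_ofReal (tendsto_inv_denom.const_mul 2)
  have hbound := MeasureTheory.Measure.hausdorffMeasure_le_liminf_tsum d
    (SparseReals ∩ {y | |y| ≤ L}) _ hr t
    (.of_forall fun N i => by
      rw [hdiam]
      exact ENNReal.ofReal_le_ofReal (mul_le_mul_of_nonneg_left (hanti (by omega)) two_pos.le))
    (.of_forall fun N y hy => by
      obtain ⟨hy, hyL⟩ := hy
      obtain ⟨n, ⟨p, hp⟩, hn⟩ := (hy.and_eventually (eventually_ge_atTop N)).exists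
      obtain ⟨j, rfl⟩ := Nat.exists_eq_add_of_le hn
      have hD : (0 : ℝ) < denom (N + j) := by exact_mod_cast denom_pos _
      have hle1 : (denom (N + j + 1) : ℝ)⁻¹ ≤ 1 :=
        inv_le_one_of_one_le₀ (by exact_mod_cast denom_pos _)
      have hyL' : |y| ≤ L := hyL
      have hpn : |(p : ℝ) / denom (N + j)| ≤ L + 1 := by
        have h1 := abs_sub_abs_le_abs_sub ((p : ℝ) / denom (N + j)) y
        rw [abs_sub_comm] at h1
        linarith
      rw [abs_div, abs_of_pos hD, div_le_iff₀ hD] at hpn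
      refine mem_iUnion.2 ⟨⟨j, p, ?_⟩, ?_⟩
      · rw [Finset.mem_Icc, ← abs_le]
        exact_mod_cast hpn
      · rw [ht, mem_Icc]
        rw [abs_le] at hp
        constructor <;> linarith [hp.1, hp.2])
  obtain ⟨N₀, hN₀⟩ := exists_nat_ge (2 / d)
  have hsum : ∀ N ≥ N₀, ∑' i, Metric.ediam (t N i) ^ d ≤
      ENNReal.ofReal ((2 * L + 3) * 2 ^ d * 2 * (2⁻¹) ^ N) := by
    intro N hN
    have hterm : ∀ j : ℕ, ∑' p : Finset.Icc (-K (N + j)) (K (N + j)),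
        Metric.ediam (t N ⟨j, p⟩) ^ d ≤
          ENNReal.ofReal ((2 * L + 3) * 2 ^ d * (2⁻¹) ^ N * (2⁻¹) ^ j) := by
      intro j
      have hn : 2 ≤ (((N + j : ℕ) : ℝ) + 1) * d := by
        have : (N₀ : ℝ) ≤ (N + j : ℕ) := by exact_mod_cast hN.trans (Nat.le_add_right N j)
        rw [← div_le_iff₀ hd]
        linarith
      have hcard : (Fintype.card (Finset.Icc (-K (N + j)) (K (N + j))) : ℝ) =
          2 * ((L + 1) * denom (N + j)) + 1 := by
        have hK : 0 ≤ K (N + j) := by positivity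
        have h : ((Fintype.card (Finset.Icc (-K (N + j)) (K (N + j))) : ℕ) : ℤ) =
            2 * K (N + j) + 1 := by
          rw [Fintype.card_coe, Int.card_Icc]
          omega
        have h' := congrArg (Int.cast : ℤ → ℝ) h
        push_cast [K] at h'
        exact h'
      simp only [hdiam]
      rw [tsum_fintype, Finset.sum_const, Finset.card_univ, nsmul_eq_mul,
        ENNReal.ofReal_rpow_of_nonneg (by positivity) hd.le, ← ENNReal.ofReal_natCast,
        ← ENNReal.ofReal_mul (Nat.cast_nonneg _), hcard, mul_assoc _ (_ ^ N) _, ← pow_add]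
      exact ENNReal.ofReal_le_ofReal (card_mul_rpow_le L hn)
    have hgeom : HasSum (fun j : ℕ => (2 * L + 3) * (2 : ℝ) ^ d * (2⁻¹) ^ N * (2⁻¹) ^ j)
        ((2 * L + 3) * 2 ^ d * 2 * (2⁻¹) ^ N) := by
      have h := (hasSum_geometric_of_lt_one (r := (2⁻¹ : ℝ)) (by norm_num) (by norm_num)).mul_left
        ((2 * L + 3) * (2 : ℝ) ^ d * (2⁻¹) ^ N)
      rwa [show (1 - (2⁻¹ : ℝ))⁻¹ = 2 by norm_num, mul_right_comm _ _ (2 : ℝ)] at h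
    rw [ENNReal.tsum_sigma']
    refine (ENNReal.tsum_le_tsum hterm).trans_eq ?_
    rw [← hgeom.tsum_eq, ENNReal.ofReal_tsum_of_nonneg (fun j => by positivity) hgeom.summable]
  have hlim : Tendsto (fun N : ℕ => ENNReal.ofReal ((2 * L + 3) * 2 ^ d * 2 * (2⁻¹) ^ N)) atTop
      (𝓝 0) := by
    have h := (tendsto_pow_atTop_nhds_zero_of_lt_one (r := (2⁻¹ : ℝ)) (by norm_num)
      (by norm_num)).const_mul ((2 * L + 3) * (2 : ℝ) ^ d * 2)
    simpa using ENNReal.tendsto_ofReal h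
  have hlim' : Tendsto (fun N => ∑' i, Metric.ediam (t N i) ^ d) atTop (𝓝 0) :=
    tendsto_of_tendsto_of_tendsto_of_le_of_le' tendsto_const_nhds hlim
      (.of_forall fun _ => zero_le) ((eventually_ge_atTop N₀).mono hsum)
  rw [hlim'.liminf_eq] at hbound
  exact le_zero_iff.1 hbound

theorem dimH_sparseReals : dimH SparseReals = 0 := by
  have hU : SparseReals = ⋃ L : ℕ, SparseReals ∩ {y | |y| ≤ L} := by
    ext y
    obtain ⟨L, hL⟩ := exists_nat_ge |y|
    simp only [mem_iUnion, mem_inter_iff, exists_and_left]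
    exact ⟨fun h => ⟨h, L, hL⟩, fun h => h.1⟩
  rw [hU, dimH_iUnion]
  refine le_zero_iff.1 (iSup_le fun L => le_of_forall_gt fun d hd => ?_)
  obtain ⟨d', hd'0, hd'⟩ := ENNReal.lt_iff_exists_nnreal_btwn.1 hd
  refine (dimH_le_of_hausdorffMeasure_ne_top ?_).trans_lt hd'
  rw [hausdorffMeasure_sparseReals_inter L (by exact_mod_cast hd'0)]
  exact ENNReal.zero_ne_top

/-! ### The transfinite construction -/

/-- Well-founded recursion for choices that are possible whenever all earlier choices were
correct. -/
theorem exists_of_forall_exists_step {ι T : Type*} [Preorder ι] [WellFoundedLT ι] [Nonempty T]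
    (Step : (i : ι) → (ι → T) → T → Prop)
    (hcongr : ∀ i f g t, (∀ j < i, f j = g j) → Step i f t → Step i g t)
    (hex : ∀ i f, (∀ j < i, Step j f (f j)) → ∃ t, Step i f t) :
    ∃ f : ι → T, ∀ i, Step i f (f i) := by
  classical
  -- The default value at `j ≥ i` is harmless, as `hcongr` makes `Step i` depend only on values
  -- below `i`.
  let ext : (i : ι) → ((j : ι) → j < i → T) → ι → T := fun i f j =>
    if h : j < i then f j h else Classical.arbitrary T
  let F : ι → T := wellFounded_lt.fix fun i f => Classical.epsilon (Step i (ext i f))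
  have hF : ∀ i, F i = Classical.epsilon (Step i (ext i fun j _ => F j)) := fun i =>
    wellFounded_lt.fix_eq _ i
  refine ⟨F, fun i => ?_⟩
  induction i using WellFoundedLT.induction with
  | ind i ih =>
    have hext : ∀ j < i, F j = ext i (fun j _ => F j) j := fun j hj => by simp only [ext, dif_pos hj]
    obtain ⟨t, ht⟩ := hex i F ih
    have h := Classical.epsilon_spec ⟨t, hcongr i _ _ t hext ht⟩
    rw [← hF] at h
    exact hcongr i _ _ _ (fun j hj => (hext j hj).symm) h

/-- If small centered families have pseudo-intersections, then some `γ`-set of reals has the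
whole line as its sum with the sparse reals. -/
theorem SmallCenteredHavePseudoIntersection.exists_isGammaSet_add_sparseReals
    (h : SmallCenteredHavePseudoIntersection) :
    ∃ X : Set ℝ, IsGammaSet X ∧ X + SparseReals = univ := by
  obtain ⟨e, heo, hint⟩ := exists_seq_isOpen_interpolating ℝ
  let ι := Cardinal.continuum.{0}.ord.ToType
  have hι : #ι = Cardinal.continuum := Cardinal.mk_ord_toType _
  obtain ⟨r, hr⟩ : ∃ r : ι → ℝ, Function.Surjective r := by
    obtain ⟨E⟩ := Cardinal.eq.1 (hι.trans Cardinal.mk_real.symm)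
    exact ⟨E, E.surjective⟩
  obtain ⟨s, hs⟩ : ∃ s : ι → ℕ → ℕ, Function.Surjective s := by
    have : #(ℕ → ℕ) = Cardinal.continuum := by simp
    obtain ⟨E⟩ := Cardinal.eq.1 (hι.trans this.symm)
    exact ⟨E, E.surjective⟩
  -- The rationals belong to `X` from the start, since thinning the support requires open sets that
  -- eventually contain each rational.
  let D : Set ℝ := range ((↑) : ℚ → ℝ)
  let Pre : ι → (ι → Set ℕ × ℝ) → Set ℝ := fun i f => D ∪ (fun j => (f j).2) '' Iio i
  let Step : ι → (ι → Set ℕ × ℝ) → Set ℕ × ℝ → Prop := fun i f t =>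
    t.1.Infinite ∧ (∀ j < i, (t.1 \ (f j).1).Finite) ∧ IsSupported t.2 t.1 ∧
      r i - t.2 ∈ SparseReals ∧
      ((∀ F ⊆ Pre i f, F.Finite → ∃ k, F ⊆ e (s i k)) →
        ∃ g : ℕ → ℕ, (∀ x ∈ Pre i f, ∀ᶠ k in atTop, x ∈ e (s i (g k))) ∧
          ∀ x, IsSupported x t.1 → ∀ᶠ k in atTop, x ∈ e (s i (g k)))
  obtain ⟨f, hf⟩ : ∃ f, ∀ i, Step i f (f i) := by
    refine exists_of_forall_exists_step Step ?_ ?_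
    · rintro i f g t hfg ⟨h1, h2, h3, h4, h5⟩
      have hPre : Pre i f = Pre i g :=
        congrArg (D ∪ ·) (image_congr fun j hj => by rw [hfg j hj])
      exact ⟨h1, fun j hj => hfg j hj ▸ h2 j hj, h3, h4, hPre ▸ h5⟩
    · intro i f hf
      have hlt : #(Iio i) < Cardinal.continuum :=
        (Cardinal.mk_Iio_lt i (by simp [ι])).trans_eq hι
      obtain ⟨b, hb, hba⟩ := h.exists_pseudoIntersection_of_tower hlt (fun j => (f j).1)
        (fun j => (hf j j.2).1) fun j k hjk => (hf k k.2).2.1 j hjk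
      obtain ⟨a, hab, ha, hg⟩ : ∃ a ⊆ b, a.Infinite ∧
          ((∀ F ⊆ Pre i f, F.Finite → ∃ k, F ⊆ e (s i k)) →
            ∃ g : ℕ → ℕ, (∀ x ∈ Pre i f, ∀ᶠ k in atTop, x ∈ e (s i (g k))) ∧
              ∀ x, IsSupported x a → ∀ᶠ k in atTop, x ∈ e (s i (g k))) := by
        by_cases hcov : ∀ F ⊆ Pre i f, F.Finite → ∃ k, F ⊆ e (s i k)
        · have hcard : #(Pre i f) < Cardinal.continuum := by
            refine (Cardinal.mk_union_le _ _).trans_lt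
              (Cardinal.add_lt_of_lt Cardinal.aleph0_le_continuum ?_ ?_)
            · exact (Cardinal.le_aleph0_iff_set_countable.2 (countable_range _)).trans_lt
                Cardinal.aleph0_lt_continuum
            · exact Cardinal.mk_image_le.trans_lt hlt
          obtain ⟨g, hg⟩ := h.exists_eventually_mem hcard (fun k => e (s i k)) hcov
          obtain ⟨a, hab, ha, φ, hφ, hW⟩ := exists_infinite_subset_eventually_mem
            (W := fun k => e (s i (g k))) (fun k => heo _)
            (fun q => hg q (Or.inl (mem_range_self q))) hb
          exact ⟨a, hab, ha, fun _ => ⟨g ∘ φ,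
            fun x hx => hφ.tendsto_atTop.eventually (hg x hx), hW⟩⟩
        · exact ⟨b, Subset.rfl, hb, fun hc => absurd hc hcov⟩
      obtain ⟨x, hx, hxr⟩ := exists_isSupported_sub_mem_sparseReals (r i) ha
      exact ⟨(a, x), ha, fun j hj => (hba ⟨j, hj⟩).subset (sdiff_subset_sdiff_left hab), hx, hxr,
        hg⟩
  refine ⟨D ∪ range fun i => (f i).2, isGammaSet_of_forall_seq hint fun u hu => ?_, ?_⟩
  · obtain ⟨i, rfl⟩ := hs u
    obtain ⟨g, hg, hg'⟩ := (hf i).2.2.2.2 fun F hF hfin =>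
      hu F (hF.trans (union_subset_union_right _ (image_subset_range _ _))) hfin
    refine ⟨g, ?_⟩
    rintro x (hx | ⟨j, rfl⟩)
    · exact hg x (Or.inl hx)
    · rcases lt_trichotomy j i with hj | rfl | hj
      · exact hg _ (Or.inr (mem_image_of_mem _ hj))
      · exact hg' _ (hf j).2.2.1
      -- A later point is supported in `f j`'s set, which is almost contained in that of `f i`.
      · exact hg' _ ((hf j).2.2.1.mono ((hf j).2.1 i hj))
  · refine eq_univ_of_forall fun z => ?_
    obtain ⟨i, rfl⟩ := hr z
    exact ⟨(f i).2, Or.inr (mem_range_self i), r i - (f i).2, (hf i).2.2.2.1, by ring⟩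

/-! ### Addition as a Lipschitz map on the plane -/

theorem image_planeProd (X Y : Set ℝ) :
    (fun p : EuclideanSpace ℝ (Fin 2) => p 0 + p 1) '' planeProd X Y = X + Y := by
  ext z
  constructor
  · rintro ⟨p, ⟨hx, hy⟩, rfl⟩
    exact add_mem_add hx hy
  · rintro ⟨x, hx, y, hy, rfl⟩
    exact ⟨!₂[x, y], ⟨by simpa using hx, by simpa using hy⟩, by simp⟩

theorem lipschitzWith_coord_add_coord :
    LipschitzWith 2 fun p : EuclideanSpace ℝ (Fin 2) => p 0 + p 1 := by
  refine LipschitzWith.of_dist_le_mul fun p q => ?_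
  have h0 := PiLp.norm_apply_le (p - q) 0
  have h1 := PiLp.norm_apply_le (p - q) 1
  rw [dist_eq_norm p q, Real.dist_eq]
  simp only [PiLp.sub_apply, Real.norm_eq_abs] at h0 h1
  calc |p 0 + p 1 - (q 0 + q 1)| = |(p 0 - q 0) + (p 1 - q 1)| := by ring_nf
    _ ≤ |p 0 - q 0| + |p 1 - q 1| := abs_add_le _ _
    _ ≤ 2 * ‖p - q‖ := by linarith

end

theorem theorem2p1
    (h : ContinuumHypothesis ∨ pseudoIntersectionNumber = Cardinal.continuum) :
    ∃ X Y : Set ℝ,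
      IsGammaSet X ∧
      dimH Y = 0 ∧
      X + Y = Set.univ ∧
      dimH (X + Y) = 1 ∧
      (∃ K : NNReal, LipschitzOnWith K
        (fun p : EuclideanSpace ℝ (Fin 2) => p 0 + p 1) (planeProd X Y)) ∧
      (fun p : EuclideanSpace ℝ (Fin 2) => p 0 + p 1) '' planeProd X Y = X + Y ∧
      1 ≤ dimH (planeProd X Y) := by
  obtain ⟨X, hX, hXY⟩ :=
    (smallCenteredHavePseudoIntersection h).exists_isGammaSet_add_sparseReals
  have hdim : dimH (X + SparseReals) = 1 := by rw [hXY, Real.dimH_univ]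
  refine ⟨X, SparseReals, hX, dimH_sparseReals, hXY, hdim,
    ⟨2, lipschitzWith_coord_add_coord.lipschitzOnWith⟩, image_planeProd X _, ?_⟩
  rw [← hdim, ← image_planeProd]
  exact lipschitzWith_coord_add_coord.dimH_image_le _
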